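/- Let $\mathcal U$ be a reflexive separable real Banach space with separable dual $\mathcal U^*$, let $(\Omega,\mathcal A,\mathbb P)$ be a complete probability space, and let $\mathcal W$ be a real topological vector space with its Borel $\sigma$-field. Let $W:\Omega\to\mathcal W$ be measurable and let $U^{ad}\subset\mathcal U$ be non-empty, closed and convex. Let $j^C,j^A:\mathcal U\times\mathcal W\to\mathbb R$ be jointly lower semicontinuous and convex in the first variable, with $j^C(\cdot,w)$ subdifferentiable on an open set containing $U^{ad}$ for every $w$. Assume that both have linearly bounded subgradients uniformly in $w$: there are $c_1,c_2,d_1,d_2>0$ such that, for all $u\in U^{ad}$ and $w\in\mathcal W$, $\|r\|\le c_1\|u\|+c_2$ for every $r\in\partial_u j^C(u,w)$ and $\|s\|\le d_1\|u\|+d_2$ for every $s\in\partial_u j^A(u,w)$. Assume that $j^C(u,W)$ and $j^A(u,W)$ are integrable for every $u\in U^{ad}$, and that $J(u)=\mathbb E[j^C(u,W)]+\mathbb E[j^A(u,W)]$ is coercive on $U^{ad}$, that is, $J(u)\to+\infty$ when $\|u\|\to+\infty$ with $u\in U^{ad}$. Let $K:\mathcal U\to\mathbb R$ be convex, lower semicontinuous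 and Gateaux-differentiable on an open set $O\supset U^{ad}$, and let $b,L_K>0$ be such that $K(v)\ge K(u)+\langle\nabla K(u),v-u\rangle+\frac b2\|u-v\|^2$ for all $u\in O$, $v\in\mathcal U$, and $\|\nabla K(v)-\nabla K(u)\|_*\le L_K\|v-u\|$ for all $u,v\in O$. Let $W_1,W_2,\dots$ be independent copies of $W$, let $\mathcal F_k=\sigma(W_1,\dots,W_k)$, let $\varepsilon_k>0$ for $k\in\mathbb N=\{0,1,2,\dots\}$, and let $(U_k)_{k\in\mathbb N}$ be the iterates of the stochastic auxiliary problem principle (APP) algorithm: $U_0=u_0\in U^{ad}$ is deterministic and, for every $k\in\mathbb N$ and $\omega\in\Omega$, $$U_{k+1}(\omega)\in\operatorname*{arg\,min}_{u\in U^{ad}}\ K(u)+\big\langle \varepsilon_k\,(G_k(\omega)+R_k(\omega))-\nabla K(U_k(\omega)),\,u\big\rangle+\varepsilon_k\, j^A(u,W_{k+1}(\omega)),$$ where $G_k,R_k:\Omega\to\mathcal U^*$ are $\mathcal F_{k+1}$-measurable and $G_k(\omega)\in\partial_u j^C(U_k(\omega),W_{k+1}(\omega))$ for every $\omega$. Let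 $Q_k=\operatorname{ess\,sup}_{\omega}\|R_k(\omega)\|_*$ and assume $\sum_{k\in\mathbb N}Q_k\varepsilon_k<\infty$. Suppose that $\varepsilon_k=ck^{-\theta}$ for all $k\ge1$, with $c>0$ and $1/2<\theta<1$, and that $Q_k\le q\,k^{-\nu}$ for all $k\ge1$, with $q>0$ and $\nu>1-\theta$. Then, for every minimizer $u^\sharp$ of $J$ over $U^{ad}$, the random variables $J(U_n)$ are integrable and $$\mathbb E\big[J(U_n)-J(u^\sharp)\big]=\mathcal O\big(n^{\theta-1}\big)\qquad(n\to\infty).$$ In particular, for every $\delta$ with $\theta\le\frac12+\delta$, this expectation is $\mathcal O(n^{-1/2+\delta})$, so the rate can be made arbitrarily close to $n^{-1/2}$ by choosing $\theta$ close to $1/2$. -/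

import Mathlib

open MeasureTheory ProbabilityTheory Filter Topology Set Asymptotics
open scoped ENNReal

/-- A normed space is reflexive: the canonical isometric embedding into its bidual is onto. -/
def ReflexiveSpace (E : Type*) [NormedAddCommGroup E] [NormedSpace ℝ E] : Prop :=
  Function.Surjective (NormedSpace.inclusionInDoubleDual ℝ E)

/-- The (convex) subdifferential `∂f(u)`, a set of continuous linear functionals. -/
def subdiff {E : Type*} [NormedAddCommGroup E] [NormedSpace ℝ E] (f : E → ℝ) (u : E) :
    Set (StrongDual ℝ E) :=
  {g | ∀ v, f u + g (v - u) ≤ f v}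

/-- `g` is the Gateaux derivative of `f` at `u`: `g` is linear and continuous and
`(f (u + t d) - f u) / t → g d` as `t → 0`, for every direction `d`. -/
def HasGateauxGradAt {E : Type*} [NormedAddCommGroup E] [NormedSpace ℝ E]
    (f : E → ℝ) (g : StrongDual ℝ E) (u : E) : Prop :=
  ∀ d, HasLineDerivAt ℝ f (g d) u d

/-- `f(u) → +∞` when `‖u‖ → +∞` with `u ∈ S`. -/
def CoerciveOn {E : Type*} [NormedAddCommGroup E] (f : E → ℝ) (S : Set E) : Prop :=
  Tendsto f (comap norm atTop ⊓ 𝓟 S) atTop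

/-- Objective function `J(u) = 𝔼[jC(u, W)] + 𝔼[jA(u, W)]` of the master problem. -/
noncomputable def objective {E 𝕎 Ω : Type*} [MeasurableSpace Ω] (P : Measure Ω)
    (jC jA : E → 𝕎 → ℝ) (W : Ω → 𝕎) (u : E) : ℝ :=
  (∫ ω, jC u (W ω) ∂P) + ∫ ω, jA u (W ω) ∂P

/-- Objective function of the auxiliary problem at the current point `u`, with step size `ε`,
subgradient `g`, additive error `r` and sample `w`:
`v ↦ K(v) + ⟨ε (g + r) - ∇K(u), v⟩ + ε jA(v, w)`. -/
noncomputable def auxObjective {E 𝕎 : Type*} [NormedAddCommGroup E] [NormedSpace ℝ E]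
    (K : E → ℝ) (gradK : E → StrongDual ℝ E) (jA : E → 𝕎 → ℝ)
    (ε : ℝ) (g r : StrongDual ℝ E) (u : E) (w : 𝕎) (v : E) : ℝ :=
  K v + (ε • (g + r) - gradK u) v + ε * jA v w

/-- `ℱ_k = σ(W₁, …, W_k)`, where the sequence of samples is indexed from `0`: `ξ k = W_{k+1}`. -/
@[reducible] def sampleSigma {Ω 𝕎 : Type*} [MeasurableSpace 𝕎] (ξ : ℕ → Ω → 𝕎) (k : ℕ) :
    MeasurableSpace Ω :=
  ⨆ i : Fin k, MeasurableSpace.comap (ξ i) inferInstance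

/-- `f : E × 𝕎 → ℝ` has linearly bounded subgradients in `u ∈ S`, uniformly in `w`. -/
def LinearlyBoundedSubgrad {E 𝕎 : Type*} [NormedAddCommGroup E] [NormedSpace ℝ E]
    (f : E → 𝕎 → ℝ) (S : Set E) : Prop :=
  ∃ c₁ > 0, ∃ c₂ > 0, ∀ u ∈ S, ∀ w, ∀ r ∈ subdiff (fun v => f v w) u, ‖r‖ ≤ c₁ * ‖u‖ + c₂

/-- Assumptions on the data of the master problem
`min {J(u) = 𝔼[jC(u, W)] + 𝔼[jA(u, W)] | u ∈ Uad}`. -/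
structure IsMasterProblem {E 𝕎 Ω : Type*} [NormedAddCommGroup E] [NormedSpace ℝ E]
    [TopologicalSpace 𝕎] [MeasurableSpace 𝕎] [MeasurableSpace Ω] (P : Measure Ω)
    (Uad : Set E) (jC jA : E → 𝕎 → ℝ) (W : Ω → 𝕎) : Prop where
  nonempty : Uad.Nonempty
  isClosed : IsClosed Uad
  convex : Convex ℝ Uad
  measurable_W : Measurable W
  lsc_jA : LowerSemicontinuous (fun p : E × 𝕎 => jA p.1 p.2)
  convex_jA : ∀ w, ConvexOn ℝ univ (fun u => jA u w)
  lsc_jC : LowerSemicontinuous (fun p : E × 𝕎 => jC p.1 p.2)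
  convex_jC : ∀ w, ConvexOn ℝ univ (fun u => jC u w)
  subdiff_jC : ∀ w, ∃ O, IsOpen O ∧ Uad ⊆ O ∧ ∀ u ∈ O, (subdiff (fun v => jC v w) u).Nonempty
  bound_jC : LinearlyBoundedSubgrad jC Uad
  bound_jA : LinearlyBoundedSubgrad jA Uad
  /-- The two expectations that define `J` on `Uad` exist and are finite. -/
  integrable_jC : ∀ u ∈ Uad, Integrable (fun ω => jC u (W ω)) P
  integrable_jA : ∀ u ∈ Uad, Integrable (fun ω => jA u (W ω)) P
  coercive : CoerciveOn (objective P jC jA W) Uad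

/-- Assumptions on the auxiliary function `K`, with gradient `∇K = gradK`: it is convex, l.s.c.,
Gateaux-differentiable on an open set `O ⊇ Uad`, and, wherever this gradient is given, it is
`b`-strongly convex with `LK`-Lipschitz gradient. -/
structure IsAuxiliaryFunction {E : Type*} [NormedAddCommGroup E] [NormedSpace ℝ E]
    (Uad O : Set E) (K : E → ℝ) (gradK : E → StrongDual ℝ E) (b LK : ℝ) : Prop where
  convex : ConvexOn ℝ univ K
  lsc : LowerSemicontinuous K
  isOpen : IsOpen O
  subset : Uad ⊆ O
  hasGrad : ∀ u ∈ O, HasGateauxGradAt K (gradK u) u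
  b_pos : 0 < b
  strong : ∀ u ∈ O, ∀ v, K u + gradK u (v - u) + b / 2 * ‖u - v‖ ^ 2 ≤ K v
  LK_pos : 0 < LK
  lipschitz : ∀ u ∈ O, ∀ v ∈ O, ‖gradK v - gradK u‖ ≤ LK * ‖v - u‖

/-- `U 0, U 1, …` is the sequence of iterates of the stochastic APP algorithm started at `u₀`,
with step sizes `ε`, samples `W_{k+1} = ξ k`, stochastic subgradients `G k` and errors `R k`. -/
structure IsStochasticAPP {E 𝕎 Ω : Type*} [NormedAddCommGroup E] [NormedSpace ℝ E]
    [MeasurableSpace 𝕎] [MeasurableSpace Ω] (P : Measure Ω)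
    (Uad : Set E) (jC jA : E → 𝕎 → ℝ) (W : Ω → 𝕎) (K : E → ℝ) (gradK : E → StrongDual ℝ E)
    (ε : ℕ → ℝ) (u₀ : E) (ξ : ℕ → Ω → 𝕎) (G R : ℕ → Ω → StrongDual ℝ E) (U : ℕ → Ω → E) :
    Prop where
  step_pos : ∀ k, 0 < ε k
  measurable_ξ : ∀ k, Measurable (ξ k)
  indep : iIndepFun ξ P
  identDistrib : ∀ k, IdentDistrib (ξ k) W P P
  start_mem : u₀ ∈ Uad
  start : ∀ ω, U 0 ω = u₀
  subgrad : ∀ k ω, G k ω ∈ subdiff (fun u => jC u (ξ k ω)) (U k ω)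
  measurable_G : ∀ k, Measurable[sampleSigma ξ (k + 1)] (G k)
  measurable_R : ∀ k, Measurable[sampleSigma ξ (k + 1)] (R k)
  next_mem : ∀ k ω, U (k + 1) ω ∈ Uad
  next_min : ∀ k ω,
    IsMinOn (auxObjective K gradK jA (ε k) (G k ω) (R k ω) (U k ω) (ξ k ω)) Uad (U (k + 1) ω)

/-- `Q = ess sup ‖R‖`, as an extended nonnegative real. -/
noncomputable def essSupNorm {E Ω : Type*} [NormedAddCommGroup E] [NormedSpace ℝ E]
    [MeasurableSpace Ω] (P : Measure Ω) (R : Ω → StrongDual ℝ E) : ℝ≥0∞ :=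
  essSup (fun ω => ‖R ω‖ₑ) P

/-! One inequality is used twice. Progress is measured by the Bregman divergence `D(u, v) = K u - K
v - ∇K(v)(u - v)`, which on `Uad` lies between `b/2 ‖u - v‖²` and `LK ‖u - v‖²`. Write `j = jC +
jA`. Optimality of `U (k+1)`, the subgradient inequalities at `U k`, and strong convexity of `K`,
which absorbs the terms linear in `‖U (k+1) - U k‖`, give `D(u, U (k+1)) ≤ D(u, U k) + ε k (j(u, ξ
k) - j(U k, ξ k)) + O(ε k² + ε k Q k)(1 + ‖U k‖² + ‖u‖²)` (`bregman_step`, `bregman_step_ae`). If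
`u` depends only on the samples before `ξ k`, independence turns `j` into `J` in expectation
(`integral_bregman_step`).

For `u = u♯`, the errors are `O(k^(-p))` with `p = min (2θ) (θ + ν) > 1`, hence summable. A Gronwall
argument (`exists_bound_of_almost_decreasing`) bounds the second moments of the iterates and the sum
of `ε k 𝔼[J(U k) - J(u♯)]`. This alone gives the rate only for weighted averages of the iterates.

For `u = U m`, the divergence vanishes at time `m`, so for every `l` the sum over `m ≤ i ≤ m + l` of
`ε i 𝔼[J(U i) - J(U m)]` is at most a constant times the sum of `i^(-p)`. Thus the weighted average
over a window ending at `n` changes little when its left end moves. Shrinking the window from length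
about `n/2` to the single index `n` costs `O(n^(θ-p) log n)`, which is `O(n^(θ-1))` because `p > 1`.
The average over the long window is itself `O(n^(θ-1))`, its total weight being of order `n^(1-θ)`
(`le_weighted_average_add`, `isBigO_rpow_of_weighted_sums`). -/

/-! ### Convex analysis: subgradients, Bregman divergence, one deterministic step. -/

section ConvexAnalysis

variable {E : Type*} [NormedAddCommGroup E] [NormedSpace ℝ E]

/-- A finite convex lower semicontinuous function on a Banach space is continuous. -/
theorem ConvexOn.continuous_of_lowerSemicontinuous [CompleteSpace E] {f : E → ℝ}
    (hf : ConvexOn ℝ univ f) (hl : LowerSemicontinuous f) : Continuous f := by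
  have hU : (⋃ n : ℕ, {x | f x ≤ n}) = univ := by
    refine eq_univ_of_forall fun x => mem_iUnion.2 ?_
    exact exists_nat_ge (f x)
  -- Baire: some closed sublevel set has an interior point, so `f` is bounded above near it, which
  -- forces a convex function to be continuous.
  obtain ⟨n, x₀, hx₀⟩ := nonempty_interior_of_iUnion_of_closed
    (fun n : ℕ => (lowerSemicontinuous_iff_isClosed_preimage.1 hl (n : ℝ))) hU
  have h1 : (𝓝 x₀).IsBoundedUnder (· ≤ ·) f :=
    ⟨n, eventually_map.2 (mem_interior_iff_mem_nhds.1 hx₀)⟩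
  have h2 := (hf.continuousOn_tfae isOpen_univ univ_nonempty).out 3 1
  rw [← continuousOn_univ]
  exact h2.1 ⟨x₀, mem_univ _, h1⟩

/-- A continuous convex function is subdifferentiable everywhere. -/
theorem ConvexOn.subdiff_nonempty {f : E → ℝ} (hf : ConvexOn ℝ univ f) (hc : Continuous f)
    (u : E) : (subdiff f u).Nonempty := by
  have hconv : Convex ℝ {p : E × ℝ | p.1 ∈ univ ∧ f p.1 < p.2} := hf.convex_strict_epigraph
  have hopen : IsOpen {p : E × ℝ | p.1 ∈ univ ∧ f p.1 < p.2} := by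
    simpa using isOpen_lt (hc.comp continuous_fst) continuous_snd
  -- Separate the open strict epigraph from the graph point over `u`. The vertical component of `F`
  -- is negative, and dividing the horizontal part by its absolute value gives the subgradient.
  obtain ⟨F, hF⟩ := geometric_hahn_banach_open_point (x := (u, f u)) hconv hopen (by simp)
  have hsplit : ∀ v t, F (v, t) = F (v, 0) + t * F (0, 1) := by
    intro v t
    have : ((v, t) : E × ℝ) = (v, 0) + t • (0, 1) := by simp
    rw [this, map_add, map_smul, smul_eq_mul]
  have hneg : F (0, 1) < 0 := by
    have := hF (u, f u + 1) (by simp)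
    rw [hsplit u (f u + 1), hsplit u (f u)] at this
    linarith
  refine ⟨(-(F (0, 1))⁻¹) • (F.comp (ContinuousLinearMap.inl ℝ E ℝ)), fun v => ?_⟩
  have hle : F (v, 0) + f v * F (0, 1) ≤ F (u, 0) + f u * F (0, 1) := by
    refine le_of_forall_pos_le_add fun δ hδ => ?_
    -- The height above the graph is chosen so that `F` drops by exactly `δ`.
    have := hF (v, f v + δ / (-F (0, 1))) (by simp; exact div_pos hδ (by linarith))
    rw [hsplit v, hsplit u (f u)] at this
    have h3 : δ / (-F (0, 1)) * F (0, 1) = -δ := by have := hneg.ne; field_simp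
    nlinarith
  have h4 : F (v - u, 0) = F (v, 0) - F (u, 0) := by
    rw [← map_sub]; simp
  simp only [smul_apply, ContinuousLinearMap.comp_apply,
    ContinuousLinearMap.inl_apply, smul_eq_mul, h4]
  have h5 : -(F (0, 1))⁻¹ * (F (v, 0) - F (u, 0)) = (F (v, 0) - F (u, 0)) / (-F (0, 1)) := by
    field_simp
  rw [h5, ← le_sub_iff_add_le', div_le_iff₀ (by linarith)]
  nlinarith

/-- The Bregman divergence of `K`, with gradient field `gradK`. -/
def bregman (K : E → ℝ) (gradK : E → StrongDual ℝ E) (u v : E) : ℝ :=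
  K u - K v - gradK v (u - v)

theorem bregman_self (K : E → ℝ) (gradK : E → StrongDual ℝ E) (u : E) :
    bregman K gradK u u = 0 := by simp [bregman]

namespace IsAuxiliaryFunction

variable {Uad O : Set E} {K : E → ℝ} {gradK : E → StrongDual ℝ E} {b LK : ℝ}

theorem le_bregman (hK : IsAuxiliaryFunction Uad O K gradK b LK) (u : E) {v : E} (hv : v ∈ Uad) :
    b / 2 * ‖u - v‖ ^ 2 ≤ bregman K gradK u v := by
  have := hK.strong v (hK.subset hv) u
  rw [norm_sub_rev] at this
  unfold bregman; linarith

theorem bregman_nonneg (hK : IsAuxiliaryFunction Uad O K gradK b LK) (u : E) {v : E}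
    (hv : v ∈ Uad) : 0 ≤ bregman K gradK u v :=
  le_trans (by have := hK.b_pos; positivity) (hK.le_bregman u hv)

/-- The symmetrized divergence is `(∇K u - ∇K v)(u - v)`, and the other half is nonnegative; no
integration along the segment is needed. -/
theorem bregman_le (hK : IsAuxiliaryFunction Uad O K gradK b LK) {u v : E} (hu : u ∈ Uad)
    (hv : v ∈ Uad) : bregman K gradK u v ≤ LK * ‖u - v‖ ^ 2 := by
  have h1 := hK.bregman_nonneg v hu
  have h2 : bregman K gradK u v + bregman K gradK v u = (gradK u - gradK v) (u - v) := by
    simp only [bregman, sub_apply, map_sub]; ring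
  have h3 := (le_abs_self _).trans ((gradK u - gradK v).le_opNorm (u - v))
  have h4 := hK.lipschitz v (hK.subset hv) u (hK.subset hu)
  have h5 := mul_le_mul_of_nonneg_right h4 (norm_nonneg (u - v))
  linarith

/-- Variational inequality for a minimizer of the auxiliary problem. -/
theorem variational_inequality {𝕎 : Type*} {jA : E → 𝕎 → ℝ}
    (hK : IsAuxiliaryFunction Uad O K gradK b LK)
    (hconv : Convex ℝ Uad) {w : 𝕎} (hjA : ConvexOn ℝ univ fun u => jA u w) {ε : ℝ} (hε : 0 < ε)
    {g r : StrongDual ℝ E} {U V : E} (hV : V ∈ Uad)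
    (hmin : IsMinOn (auxObjective K gradK jA ε g r U w) Uad V) {u : E} (hu : u ∈ Uad) :
    0 ≤ (gradK V - gradK U) (u - V) + ε * (g + r) (u - V) + ε * (jA u w - jA V w) := by
  have hd := (hK.hasGrad V (hK.subset hV) (u - V)).tendsto_slope_zero_right
  -- Minimality at `V`, tested at `V + t (u - V)` with convexity of `jA`, bounds the difference
  -- quotient of `K` from below; then `t → 0⁺`.
  have key : ∀ᶠ t : ℝ in 𝓝[>] 0, -((ε • (g + r) - gradK U) (u - V) + ε * (jA u w - jA V w))
      ≤ t⁻¹ • (K (V + t • (u - V)) - K V) := by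
    filter_upwards [Ioc_mem_nhdsGT (zero_lt_one : (0 : ℝ) < 1)] with t ht
    have hmem : V + t • (u - V) ∈ Uad := hconv.add_smul_sub_mem hV hu ⟨ht.1.le, ht.2⟩
    have h1 := isMinOn_iff.1 hmin _ hmem
    have h2 : jA (V + t • (u - V)) w ≤ (1 - t) * jA V w + t * jA u w := by
      have := hjA.2 (mem_univ V) (mem_univ u) (sub_nonneg.2 ht.2) ht.1.le (by ring)
      rwa [← show V + t • (u - V) = (1 - t) • V + t • u by module] at this
    simp only [auxObjective, map_add, map_smul, smul_eq_mul] at h1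
    rw [smul_eq_mul, ← div_eq_inv_mul, le_div_iff₀ ht.1]
    nlinarith
  have := ge_of_tendsto hd key
  simp only [sub_apply, smul_apply, smul_eq_mul] at this ⊢
  linarith

/-- The basic one-step inequality of the auxiliary problem principle. -/
theorem bregman_step {𝕎 : Type*} {jC jA : E → 𝕎 → ℝ}
    (hK : IsAuxiliaryFunction Uad O K gradK b LK)
    (hconv : Convex ℝ Uad) {w : 𝕎} (hjA : ConvexOn ℝ univ fun u => jA u w) {ε : ℝ} (hε : 0 < ε)
    {g r s : StrongDual ℝ E} {U V : E} (hU : U ∈ Uad) (hV : V ∈ Uad)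
    (hg : g ∈ subdiff (fun v => jC v w) U) (hs : s ∈ subdiff (fun v => jA v w) U)
    {M : ℝ} (hM : ‖g‖ + ‖s‖ + ‖r‖ ≤ M)
    (hmin : IsMinOn (auxObjective K gradK jA ε g r U w) Uad V) {u : E} (hu : u ∈ Uad) :
    bregman K gradK u V ≤ bregman K gradK u U + ε * ((jC u w + jA u w) - (jC U w + jA U w))
      + ε ^ 2 * M ^ 2 / (2 * b) + ε * (‖r‖ * ‖u - U‖) := by
  have hvi := hK.variational_inequality hconv hjA hε hV hmin hu
  have hb := hK.le_bregman V hU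
  have hbp := hK.b_pos
  have h1 : bregman K gradK u U - bregman K gradK u V
      = bregman K gradK V U + (gradK V - gradK U) (u - V) := by
    simp only [bregman, sub_apply, map_sub]; ring
  have hgu := hg u
  have hsV := hs V
  have e1 : (g + r) (u - V) = g (u - U) + (-g) (V - U) + r (u - U) + (-r) (V - U) := by
    simp only [add_apply, neg_apply, map_sub]; ring
  have n1 := (le_abs_self _).trans ((-g).le_opNorm (V - U))
  have n2 := (le_abs_self _).trans ((-r).le_opNorm (V - U))
  have n3 := (le_abs_self _).trans (r.le_opNorm (u - U))
  have n4 := (le_abs_self _).trans ((-s).le_opNorm (V - U))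
  rw [norm_neg] at n1 n2 n4
  simp only [neg_apply] at n4
  -- The error is split as `r (u - V) = r (u - U) - r (V - U)`. The second part joins `g` and `s` in
  -- the `M ‖V - U‖` term; only the first remains of first order in `ε`.
  have hb1 : (g + r) (u - V) + (jA u w - jA V w)
      ≤ ((jC u w + jA u w) - (jC U w + jA U w)) + M * ‖V - U‖ + ‖r‖ * ‖u - U‖ := by
    have := mul_le_mul_of_nonneg_right hM (norm_nonneg (V - U))
    simp only at hgu hsV
    linarith
  have hb2 := mul_le_mul_of_nonneg_left hb1 hε.le
  -- Completing the square; the quadratic term is the one supplied by `hb`.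
  have hsq : ε * (M * ‖V - U‖) ≤ ε ^ 2 * M ^ 2 / (2 * b) + b / 2 * ‖V - U‖ ^ 2 := by
    have : ε ^ 2 * M ^ 2 / (2 * b) + b / 2 * ‖V - U‖ ^ 2 - ε * (M * ‖V - U‖)
        = (ε * M - b * ‖V - U‖) ^ 2 / (2 * b) := by field_simp; ring
    have : 0 ≤ (ε * M - b * ‖V - U‖) ^ 2 / (2 * b) := by positivity
    linarith
  linarith

/-- The minimum of the auxiliary problem grows quadratically. -/
theorem auxObjective_growth {𝕎 : Type*} {jA : E → 𝕎 → ℝ}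
    (hK : IsAuxiliaryFunction Uad O K gradK b LK)
    (hconv : Convex ℝ Uad) {w : 𝕎} (hjA : ConvexOn ℝ univ fun u => jA u w) {ε : ℝ} (hε : 0 < ε)
    {g r : StrongDual ℝ E} {U V : E} (hV : V ∈ Uad)
    (hmin : IsMinOn (auxObjective K gradK jA ε g r U w) Uad V) {u : E} (hu : u ∈ Uad) :
    auxObjective K gradK jA ε g r U w V + b / 2 * ‖u - V‖ ^ 2
      ≤ auxObjective K gradK jA ε g r U w u := by
  have h1 := hK.variational_inequality hconv hjA hε hV hmin hu
  have h2 := hK.strong V (hK.subset hV) u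
  rw [norm_sub_rev] at h2
  simp only [auxObjective, sub_apply, add_apply, smul_apply, smul_eq_mul, map_sub] at *
  linarith

end IsAuxiliaryFunction

namespace IsMasterProblem

variable {𝕎 Ω : Type*} [TopologicalSpace 𝕎] [MeasurableSpace 𝕎] [MeasurableSpace Ω]
  {P : Measure Ω} {Uad : Set E} {jC jA : E → 𝕎 → ℝ} {W : Ω → 𝕎}

theorem continuous_jC [CompleteSpace E] (h : IsMasterProblem P Uad jC jA W) (w : 𝕎) :
    Continuous fun u => jC u w :=
  (h.convex_jC w).continuous_of_lowerSemicontinuous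
    (h.lsc_jC.comp (g := fun u : E => (u, w)) (by fun_prop))

theorem continuous_jA [CompleteSpace E] (h : IsMasterProblem P Uad jC jA W) (w : 𝕎) :
    Continuous fun u => jA u w :=
  (h.convex_jA w).continuous_of_lowerSemicontinuous
    (h.lsc_jA.comp (g := fun u : E => (u, w)) (by fun_prop))

theorem measurable_jC [OpensMeasurableSpace 𝕎] (h : IsMasterProblem P Uad jC jA W) (u : E) :
    Measurable (jC u) :=
  (h.lsc_jC.comp (g := fun w : 𝕎 => (u, w)) (by fun_prop)).measurable

theorem measurable_jA [OpensMeasurableSpace 𝕎] (h : IsMasterProblem P Uad jC jA W) (u : E) :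
    Measurable (jA u) :=
  (h.lsc_jA.comp (g := fun w : 𝕎 => (u, w)) (by fun_prop)).measurable

/-- A single constant controls the subgradients of both parts of the cost. -/
theorem exists_subgrad_bound [CompleteSpace E] (h : IsMasterProblem P Uad jC jA W) :
    ∃ a > 0, ∀ u ∈ Uad, ∀ w, ∀ g ∈ subdiff (fun v => jC v w) u,
      ∃ s ∈ subdiff (fun v => jA v w) u, ‖g‖ + ‖s‖ ≤ a * (1 + ‖u‖) := by
  obtain ⟨c₁, hc₁, c₂, hc₂, hc⟩ := h.bound_jC
  obtain ⟨d₁, hd₁, d₂, hd₂, hd⟩ := h.bound_jA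
  refine ⟨c₁ + c₂ + d₁ + d₂, by positivity, fun u hu w g hg => ?_⟩
  obtain ⟨s, hs⟩ := (h.convex_jA w).subdiff_nonempty (h.continuous_jA w) u
  refine ⟨s, hs, ?_⟩
  have h1 := hc u hu w g hg
  have h2 := hd u hu w s hs
  have := norm_nonneg u
  nlinarith [mul_nonneg hc₂.le this, mul_nonneg hd₂.le this]

theorem sub_le_of_subgrad_bound (h : IsMasterProblem P Uad jC jA W) {a : ℝ}
    (ha : ∀ u ∈ Uad, ∀ w, ∀ g ∈ subdiff (fun v => jC v w) u,
      ∃ s ∈ subdiff (fun v => jA v w) u, ‖g‖ + ‖s‖ ≤ a * (1 + ‖u‖))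
    {u : E} (hu : u ∈ Uad) (v : E) (w : 𝕎) :
    (jC u w + jA u w) - (jC v w + jA v w) ≤ a * (1 + ‖u‖) * ‖u - v‖ := by
  obtain ⟨O, -, hO, hne⟩ := h.subdiff_jC w
  obtain ⟨g, hg⟩ := hne u (hO hu)
  obtain ⟨s, hs, hb⟩ := ha u hu w g hg
  have h1 := hg v
  have h2 := hs v
  have n1 := (le_abs_self _).trans ((-g).le_opNorm (v - u))
  have n2 := (le_abs_self _).trans ((-s).le_opNorm (v - u))
  rw [norm_neg, norm_sub_rev] at n1 n2
  simp only [neg_apply] at n1 n2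
  have := mul_le_mul_of_nonneg_right hb (norm_nonneg (u - v))
  simp only at h1 h2
  linarith

/-- The bound is uniform in `w`, so integrability of the sampled cost at one fixed point passes to
every square integrable random point of `Uad`. -/
theorem abs_sub_le_of_subgrad_bound (h : IsMasterProblem P Uad jC jA W) {a : ℝ} (ha0 : 0 < a)
    (ha : ∀ u ∈ Uad, ∀ w, ∀ g ∈ subdiff (fun v => jC v w) u,
      ∃ s ∈ subdiff (fun v => jA v w) u, ‖g‖ + ‖s‖ ≤ a * (1 + ‖u‖))
    {u v : E} (hu : u ∈ Uad) (hv : v ∈ Uad) (w : 𝕎) :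
    |(jC u w + jA u w) - (jC v w + jA v w)| ≤ a * (1 + ‖u‖ + ‖v‖) * (‖u‖ + ‖v‖) := by
  have h1 := h.sub_le_of_subgrad_bound ha hu v w
  have h2 := h.sub_le_of_subgrad_bound ha hv u w
  have h3 := norm_sub_le u v
  rw [norm_sub_rev] at h2
  have nu := norm_nonneg u
  have nv := norm_nonneg v
  have h4 : a * (1 + ‖u‖) * ‖u - v‖ ≤ a * (1 + ‖u‖ + ‖v‖) * (‖u‖ + ‖v‖) :=
    mul_le_mul (mul_le_mul_of_nonneg_left (by linarith) ha0.le) h3 (norm_nonneg _)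
      (by positivity)
  have h5 : a * (1 + ‖v‖) * ‖u - v‖ ≤ a * (1 + ‖u‖ + ‖v‖) * (‖u‖ + ‖v‖) :=
    mul_le_mul (mul_le_mul_of_nonneg_left (by linarith) ha0.le) h3 (norm_nonneg _)
      (by positivity)
  rw [abs_le]
  constructor <;> linarith

end IsMasterProblem

end ConvexAnalysis

/-! ### Measurability of the iterates, independence, and averaging over a fresh sample. -/

section Measurability

/-- The minimizer of a random function with quadratic growth is measurable. -/
theorem measurable_of_quadratic_growth {Ω E : Type*} [MeasurableSpace Ω] [NormedAddCommGroup E]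
    [SecondCountableTopology E] [MeasurableSpace E] [BorelSpace E]
    {S : Set E} {φ : Ω → E → ℝ} {X : Ω → E} {b : ℝ} (hb : 0 < b)
    (hφ : ∀ v ∈ S, Measurable fun ω => φ ω v) (hc : ∀ ω, Continuous (φ ω))
    (hX : ∀ ω, X ω ∈ S) (hgrow : ∀ ω, ∀ v ∈ S, φ ω (X ω) + b * ‖v - X ω‖ ^ 2 ≤ φ ω v) :
    Measurable X := by
  rcases isEmpty_or_nonempty Ω with hΩ | ⟨⟨ω₀⟩⟩
  · exact measurable_of_empty X
  have : Nonempty S := ⟨⟨X ω₀, hX ω₀⟩⟩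
  set d : ℕ → S := TopologicalSpace.denseSeq S
  have hmin : ∀ ω j, φ ω (X ω) ≤ φ ω (d j) := fun ω j => by
    have := hgrow ω (d j) (d j).2
    have : 0 ≤ b * ‖(d j : E) - X ω‖ ^ 2 := by positivity
    linarith
  have hdense : ∀ ω, ∀ δ > 0, ∃ i, φ ω (d i) < φ ω (X ω) + δ := fun ω δ hδ => by
    have hopen : IsOpen {v : S | φ ω v < φ ω (X ω) + δ} :=
      isOpen_lt ((hc ω).comp continuous_subtype_val) continuous_const
    obtain ⟨_, h, ⟨i, rfl⟩⟩ := (TopologicalSpace.denseRange_denseSeq S).inter_open_nonempty _ hopen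
      ⟨⟨X ω, hX ω⟩, by simpa using hδ⟩
    exact ⟨i, h⟩
  -- Near-minimality is tested only against the dense sequence, so it is a countable family of
  -- measurable conditions that does not mention `X`. Quadratic growth then makes the selected
  -- points converge to `X`.
  have hex : ∀ (n : ℕ) ω, ∃ i, ∀ j, φ ω (d i) ≤ φ ω (d j) + 1 / ((n : ℝ) + 1) := fun n ω => by
    obtain ⟨i, hi⟩ := hdense ω (1 / ((n : ℝ) + 1)) Nat.one_div_pos_of_nat
    exact ⟨i, fun j => hi.le.trans (by linarith [hmin ω j])⟩
  classical
  refine measurable_of_tendsto_metrizable (f := fun n ω => (d (Nat.find (hex n ω)) : E))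
    (fun n => ?_) (tendsto_pi_nhds.2 fun ω => ?_)
  · refine (measurable_from_nat (f := fun i => (d i : E))).comp (measurable_find (hex n) fun i => ?_)
    simp only [ofPred_forall]
    exact MeasurableSet.iInter fun j => measurableSet_le (hφ _ (d i).2)
      ((hφ _ (d j).2).add_const _)
  · have hle : ∀ n : ℕ, ‖(d (Nat.find (hex n ω)) : E) - X ω‖ ^ 2 ≤ b⁻¹ * (1 / ((n : ℝ) + 1)) := by
      intro n
      have h1 := Nat.find_spec (hex n ω)
      have h2 : φ ω (d (Nat.find (hex n ω))) ≤ φ ω (X ω) + 1 / ((n : ℝ) + 1) := by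
        refine le_of_forall_pos_le_add fun δ hδ => ?_
        obtain ⟨j, hj⟩ := hdense ω δ hδ
        linarith [h1 j]
      have h3 := hgrow ω _ (d (Nat.find (hex n ω))).2
      rw [← div_eq_inv_mul, le_div_iff₀ hb]
      linarith
    have h0 : Tendsto (fun n : ℕ => b⁻¹ * (1 / ((n : ℝ) + 1))) atTop (𝓝 0) := by
      simpa using tendsto_one_div_add_atTop_nhds_zero_nat.const_mul b⁻¹
    have h1 := squeeze_zero (fun n => sq_nonneg _) hle h0
    rw [tendsto_iff_norm_sub_tendsto_zero]
    have h2 := (Real.continuous_sqrt.tendsto 0).comp h1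
    simpa [Function.comp_def, Real.sqrt_sq] using h2

variable {E : Type*} [NormedAddCommGroup E] [NormedSpace ℝ E]

namespace IsAuxiliaryFunction

variable {Uad O : Set E} {K : E → ℝ} {gradK : E → StrongDual ℝ E} {b LK : ℝ}

theorem continuousOn_gradK (hK : IsAuxiliaryFunction Uad O K gradK b LK) :
    ContinuousOn gradK Uad := by
  refine (LipschitzOnWith.of_dist_le_mul (K := ⟨LK, hK.LK_pos.le⟩) fun u hu v hv => ?_).continuousOn
  rw [dist_eq_norm, dist_eq_norm]
  exact hK.lipschitz v (hK.subset hv) u (hK.subset hu)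

/-- `gradK` is known to be continuous only on `Uad`, hence the passage through the subtype. -/
theorem measurable_gradK_comp [MeasurableSpace E] [BorelSpace E] {Ω : Type*} [MeasurableSpace Ω]
    (hK : IsAuxiliaryFunction Uad O K gradK b LK) {X : Ω → E} (hX : Measurable X)
    (hmem : ∀ ω, X ω ∈ Uad) : Measurable fun ω => gradK (X ω) :=
  (continuousOn_iff_continuous_domRestrict.1 hK.continuousOn_gradK).measurable.comp
    (hX.subtype_mk (h := hmem))

theorem measurable_bregman [CompleteSpace E] [SecondCountableTopology E] [MeasurableSpace E]
    [BorelSpace E] {Ω : Type*} [MeasurableSpace Ω]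
    (hK : IsAuxiliaryFunction Uad O K gradK b LK) {X Y : Ω → E} (hX : Measurable X)
    (hY : Measurable Y) (hmem : ∀ ω, Y ω ∈ Uad) :
    Measurable fun ω => bregman K gradK (X ω) (Y ω) := by
  have hKc := (hK.convex.continuous_of_lowerSemicontinuous hK.lsc).measurable
  have hg := hK.measurable_gradK_comp hY hmem
  have hu : Measurable (Function.uncurry fun (v : E) (g : StrongDual ℝ E) => g v) :=
    measurable_uncurry_of_continuous_of_measurable (fun g => g.continuous)
      (fun v => ContinuousLinearMap.measurable_apply v)
  exact ((hKc.comp hX).sub (hKc.comp hY)).sub (hu.comp ((hX.sub hY).prodMk hg))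

end IsAuxiliaryFunction

namespace IsMasterProblem

variable {𝕎 Ω : Type*} [TopologicalSpace 𝕎] [MeasurableSpace 𝕎] [MeasurableSpace Ω]
  {P : Measure Ω} {Uad : Set E} {jC jA : E → 𝕎 → ℝ} {W : Ω → 𝕎}

/-- A Carathéodory argument: continuous in `u`, measurable in `w`. Joint semicontinuity would only
give Borel measurability on `E × 𝕎`, whose Borel σ-algebra may be larger than the product one. -/
theorem measurable_uncurry [CompleteSpace E] [SecondCountableTopology E] [MeasurableSpace E]
    [BorelSpace E] [OpensMeasurableSpace 𝕎] (h : IsMasterProblem P Uad jC jA W) :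
    Measurable fun p : E × 𝕎 => jC p.1 p.2 + jA p.1 p.2 :=
  (measurable_uncurry_of_continuous_of_measurable h.continuous_jC h.measurable_jC).add
    (measurable_uncurry_of_continuous_of_measurable h.continuous_jA h.measurable_jA)

theorem objective_eq_integral_map [OpensMeasurableSpace 𝕎] (h : IsMasterProblem P Uad jC jA W)
    {u : E} (hu : u ∈ Uad) :
    objective P jC jA W u = ∫ w, jC u w + jA u w ∂(P.map W) := by
  rw [objective, ← integral_add (h.integrable_jC u hu) (h.integrable_jA u hu),
    integral_map (f := fun w => jC u w + jA u w) h.measurable_W.aemeasurable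
      ((h.measurable_jC u).add (h.measurable_jA u)).aestronglyMeasurable]

/-- The cost at an independent sample averages to the objective. -/
theorem integral_objective_comp [IsProbabilityMeasure P] [CompleteSpace E]
    [SecondCountableTopology E] [MeasurableSpace E] [BorelSpace E]
    [OpensMeasurableSpace 𝕎] (h : IsMasterProblem P Uad jC jA W) {X : Ω → E} {Y : Ω → 𝕎}
    (hX : Measurable X) (hY : Measurable Y) (hmem : ∀ ω, X ω ∈ Uad) (hid : IdentDistrib Y W P P)
    (hind : X ⟂ᵢ[P] Y) (hint : Integrable (fun ω => jC (X ω) (Y ω) + jA (X ω) (Y ω)) P) :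
    Integrable (fun ω => objective P jC jA W (X ω)) P ∧
      ∫ ω, objective P jC jA W (X ω) ∂P = ∫ ω, jC (X ω) (Y ω) + jA (X ω) (Y ω) ∂P := by
  -- By independence the joint law is a product, so Fubini integrates out the sample first.
  have hmap := hind.map_prod_eq_prod_map_map hX.aemeasurable hY.aemeasurable
  have : IsProbabilityMeasure (P.map X) := Measure.isProbabilityMeasure_map hX.aemeasurable
  have : IsProbabilityMeasure (P.map Y) := Measure.isProbabilityMeasure_map hY.aemeasurable
  have hF := h.measurable_uncurry
  have hXY : AEMeasurable (fun ω => (X ω, Y ω)) P := (hX.prodMk hY).aemeasurable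
  have hint' : Integrable (fun p : E × 𝕎 => jC p.1 p.2 + jA p.1 p.2)
      ((P.map X).prod (P.map Y)) := by
    rw [← hmap, integrable_map_measure hF.aestronglyMeasurable hXY]
    exact hint
  have hobj : ∀ ω, objective P jC jA W (X ω)
      = ∫ w, jC (X ω) w + jA (X ω) w ∂(P.map Y) := fun ω => by
    rw [h.objective_eq_integral_map (hmem ω), hid.map_eq]
  have hl := hint'.integral_prod_left
  simp_rw [hobj]
  constructor
  · exact hl.comp_aemeasurable hX.aemeasurable
  · rw [← integral_map hX.aemeasurable (f := fun u => ∫ w, jC u w + jA u w ∂(P.map Y))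
      hl.aestronglyMeasurable, ← integral_prod _ hint', ← hmap,
      integral_map hXY hF.aestronglyMeasurable]

end IsMasterProblem

theorem sampleSigma_mono {Ω 𝕎 : Type*} [MeasurableSpace 𝕎] (ξ : ℕ → Ω → 𝕎) :
    Monotone (sampleSigma ξ) := fun _ n hmn =>
  iSup_le fun i => le_iSup (fun j : Fin n => MeasurableSpace.comap (ξ j) inferInstance)
    (Fin.castLE hmn i)

namespace IsStochasticAPP

variable {𝕎 Ω : Type*} [MeasurableSpace 𝕎] [MeasurableSpace Ω]
  {P : Measure Ω} {Uad O : Set E} {jC jA : E → 𝕎 → ℝ} {W : Ω → 𝕎}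
  {K : E → ℝ} {gradK : E → StrongDual ℝ E} {b LK : ℝ}
  {ε : ℕ → ℝ} {u₀ : E} {ξ : ℕ → Ω → 𝕎} {G R : ℕ → Ω → StrongDual ℝ E} {U : ℕ → Ω → E}

theorem mem (halg : IsStochasticAPP P Uad jC jA W K gradK ε u₀ ξ G R U) :
    ∀ k ω, U k ω ∈ Uad
  | 0, ω => halg.start ω ▸ halg.start_mem
  | k + 1, ω => halg.next_mem k ω

theorem sampleSigma_le (halg : IsStochasticAPP P Uad jC jA W K gradK ε u₀ ξ G R U) (k : ℕ) :
    sampleSigma ξ k ≤ ‹MeasurableSpace Ω› :=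
  iSup_le fun i => (halg.measurable_ξ i).comap_le

/-- `sampleSigma ξ k` involves only `ξ i` with `i < k`, so `ξ k` is still fresh at step `k`. -/
theorem indepFun_of_measurable [MeasurableSpace E]
    (halg : IsStochasticAPP P Uad jC jA W K gradK ε u₀ ξ G R U) {k : ℕ} {X : Ω → E}
    (hX : Measurable[sampleSigma ξ k] X) : X ⟂ᵢ[P] ξ k := by
  have h := indep_iSup_of_disjoint (fun i => (halg.measurable_ξ i).comap_le) halg.indep
    (S := Iio k) (T := {k}) (by simp)
  rw [IndepFun_iff_Indep]
  refine indep_of_indep_of_le_right (indep_of_indep_of_le_left h ?_) ?_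
  · refine hX.comap_le.trans (iSup_le fun i => ?_)
    exact le_iSup₂_of_le (i : ℕ) i.2 le_rfl
  · exact le_iSup₂_of_le k rfl le_rfl

/-- The iterates are adapted to the filtration of the samples. -/
theorem measurable_iterate [TopologicalSpace 𝕎] [CompleteSpace E] [SecondCountableTopology E]
    [MeasurableSpace E] [BorelSpace E] [OpensMeasurableSpace 𝕎]
    (hprob : IsMasterProblem P Uad jC jA W) (hK : IsAuxiliaryFunction Uad O K gradK b LK)
    (halg : IsStochasticAPP P Uad jC jA W K gradK ε u₀ ξ G R U) (k : ℕ) :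
    Measurable[sampleSigma ξ k] (U k) := by
  induction k with
  | zero =>
    have : U 0 = fun _ => u₀ := funext halg.start
    rw [this]
    exact @measurable_const _ _ _ (sampleSigma ξ 0) _
  | succ k ih =>
    refine @measurable_of_quadratic_growth Ω E (sampleSigma ξ (k + 1)) _ _ _ _ Uad
      (fun ω => auxObjective K gradK jA (ε k) (G k ω) (R k ω) (U k ω) (ξ k ω)) _ (b / 2)
      (half_pos hK.b_pos) (fun v _ => ?_) (fun ω => ?_) (halg.next_mem k) (fun ω v hv => ?_)
    · have hU := ih.mono (sampleSigma_mono ξ k.le_succ) le_rfl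
      have hgK := @IsAuxiliaryFunction.measurable_gradK_comp E _ _ Uad O K gradK b LK _ _ Ω
        (sampleSigma ξ (k + 1)) hK _ hU (halg.mem k)
      have hξ : Measurable[sampleSigma ξ (k + 1)] (ξ k) :=
        (comap_measurable (ξ k)).mono (le_iSup (fun i : Fin (k + 1) =>
          MeasurableSpace.comap (ξ i) inferInstance) (Fin.last k)) le_rfl
      have hv := ContinuousLinearMap.measurable_apply (𝕜 := ℝ) (F := ℝ) v
      have h1 := hv.comp (halg.measurable_G k)
      have h2 := hv.comp (halg.measurable_R k)
      have h3 := hv.comp hgK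
      have h4 := (hprob.measurable_jA v).comp hξ
      simp only [auxObjective, sub_apply, add_apply, smul_apply, smul_eq_mul]
      exact ((((h1.add h2).const_mul (ε k)).sub h3).const_add (K v)).add (h4.const_mul (ε k))
    · have hKc := hK.convex.continuous_of_lowerSemicontinuous hK.lsc
      exact (hKc.add (ContinuousLinearMap.continuous _)).add
        ((hprob.continuous_jA _).const_mul _)
    · exact hK.auxObjective_growth hprob.convex (hprob.convex_jA _) (halg.step_pos k)
        (halg.next_mem k ω) (halg.next_min k ω) hv

end IsStochasticAPP

end Measurability

/-! ### Real sequences: from weighted sums to the last term. -/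

section RealSequences

/-- Comparison of the first term of a sequence with its weighted averages. -/
theorem le_weighted_average_add {η x δ : ℕ → ℝ} {L : ℕ} (hη : ∀ i ≤ L, 0 < η i)
    (h : ∀ j ≤ L, ∑ i ∈ Finset.range (j + 1), η i * (x i - x j) ≤ δ j) :
    x 0 ≤ (∑ i ∈ Finset.range (L + 1), η i * x i) / ∑ i ∈ Finset.range (L + 1), η i
      + ∑ j ∈ Finset.range L, η (j + 1) * δ (j + 1) /
        ((∑ i ∈ Finset.range (j + 1), η i) * ∑ i ∈ Finset.range (j + 2), η i) := by
  have hpos : ∀ j ≤ L, 0 < ∑ i ∈ Finset.range (j + 1), η i := fun j hj =>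
    Finset.sum_pos (fun i hi => hη i (by have := Finset.mem_range.1 hi; omega)) (by simp)
  induction L with
  | zero =>
    have := hη 0 le_rfl
    simp [mul_div_assoc, mul_div_cancel_left₀ _ this.ne']
  | succ L ih =>
    refine (ih (fun i hi => hη i (by omega)) (fun j hj => h j (by omega))
      (fun j hj => hpos j (by omega))).trans ?_
    rw [Finset.sum_range_succ (fun j => η (j + 1) * δ (j + 1) / _) L]
    have ht := hpos L (by omega)
    have ht' := hpos (L + 1) le_rfl
    have hη' := hη (L + 1) le_rfl
    have hδ := h (L + 1) le_rfl
    simp only [mul_sub, Finset.sum_sub_distrib, ← Finset.sum_mul] at hδ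
    rw [add_comm (Finset.sum _ _) (_ / _), ← add_assoc]
    gcongr
    rw [show L + 2 = L + 1 + 1 from rfl] at *
    rw [Finset.sum_range_succ _ (L + 1)] at ht'
    simp only [Finset.sum_range_succ _ (L + 1)] at hδ ⊢
    generalize ∑ i ∈ Finset.range (L + 1), η i = t at *
    generalize ∑ i ∈ Finset.range (L + 1), η i * x i = s at *
    have e : (s + η (L + 1) * x (L + 1)) / (t + η (L + 1))
        + η (L + 1) * δ (L + 1) / (t * (t + η (L + 1))) - s / t
        = η (L + 1) * (δ (L + 1) - (s + η (L + 1) * x (L + 1) - (t + η (L + 1)) * x (L + 1)))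
          / (t * (t + η (L + 1))) := by
      field_simp
      ring
    have : 0 ≤ η (L + 1) * (δ (L + 1) - (s + η (L + 1) * x (L + 1) - (t + η (L + 1)) * x (L + 1)))
          / (t * (t + η (L + 1))) := by
      apply div_nonneg (mul_nonneg hη'.le (by linarith)) (by positivity)
    linarith

/-- Convergence rate of a sequence whose weighted sums are controlled from every index on. -/
theorem isBigO_rpow_of_weighted_sums {e : ℕ → ℝ} {c θ p S C : ℝ} (he : ∀ k, 0 ≤ e k) (hc : 0 < c)
    (hθ0 : 0 < θ) (hθ1 : θ < 1) (hp : 1 < p) (hC : 0 ≤ C)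
    (hS : ∀ n, ∑ k ∈ Finset.range n, (c * ((k + 1 : ℕ) : ℝ) ^ (-θ)) * e (k + 1) ≤ S)
    (hm : ∀ m l : ℕ, 1 ≤ m → ∑ i ∈ Finset.range (l + 1),
      (c * ((m + i : ℕ) : ℝ) ^ (-θ)) * (e (m + i) - e m)
        ≤ ∑ i ∈ Finset.range (l + 1), C * ((m + i : ℕ) : ℝ) ^ (-p)) :
    e =O[atTop] fun n : ℕ => (n : ℝ) ^ (θ - 1) := by
  have hS0 : 0 ≤ S := by simpa using hS 0
  refine IsBigO.of_bound (2 * S / c + 2 ^ (θ + p) * C / c * (1 + 1 / (p - 1))) ?_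
  filter_upwards [eventually_ge_atTop 2] with n hn
  have hn0 : (0 : ℝ) < n := by positivity
  rw [Real.norm_of_nonneg (he n), Real.norm_of_nonneg (by positivity)]
  -- Time is reversed from `n`. On the window `[n - L, n]` all weights are comparable to `c n^(-θ)`,
  -- and all errors are at most a constant times `n^(-p)`.
  set L := n / 2 with hL
  set η : ℕ → ℝ := fun i => c * ((n - i : ℕ) : ℝ) ^ (-θ) with hηdef
  have hcast : ∀ i ≤ L, (n : ℝ) / 2 ≤ ((n - i : ℕ) : ℝ) := by
    intro i hi
    have : n ≤ 2 * (n - i) := by omega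
    have : (n : ℝ) ≤ 2 * ((n - i : ℕ) : ℝ) := by exact_mod_cast this
    linarith
  have hcast' : ∀ i ≤ L, ((n - i : ℕ) : ℝ) ≤ n := fun i _ => by exact_mod_cast Nat.sub_le n i
  have hη_low : ∀ i ≤ L, c * (n : ℝ) ^ (-θ) ≤ η i := fun i hi => by
    have h1 := hcast i hi
    have h2 := Real.rpow_le_rpow_of_nonpos (by linarith) (hcast' i hi) (neg_nonpos.2 hθ0.le)
    exact mul_le_mul_of_nonneg_left h2 hc.le
  have hη_up : ∀ i ≤ L, η i ≤ 2 ^ θ * c * (n : ℝ) ^ (-θ) := fun i hi => by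
    have h1 := hcast i hi
    have h2 := Real.rpow_le_rpow_of_nonpos (by positivity) h1 (neg_nonpos.2 hθ0.le)
    rw [Real.div_rpow hn0.le (by norm_num), Real.rpow_neg (by norm_num : (0 : ℝ) ≤ 2),
      div_inv_eq_mul] at h2
    calc η i ≤ c * ((n : ℝ) ^ (-θ) * 2 ^ θ) := mul_le_mul_of_nonneg_left h2 hc.le
      _ = _ := by ring
  have hp_up : ∀ i ≤ L, ((n - i : ℕ) : ℝ) ^ (-p) ≤ 2 ^ p * (n : ℝ) ^ (-p) := fun i hi => by
    have h2 := Real.rpow_le_rpow_of_nonpos (by positivity) (hcast i hi)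
      (by linarith : -p ≤ 0)
    rwa [Real.div_rpow hn0.le (by norm_num), Real.rpow_neg (by norm_num : (0 : ℝ) ≤ 2),
      div_inv_eq_mul, mul_comm] at h2
  have hη_pos : ∀ i ≤ L, 0 < η i := fun i hi => lt_of_lt_of_le (by positivity) (hη_low i hi)
  have ht_low : ∀ j ≤ L, ((j : ℝ) + 1) * (c * (n : ℝ) ^ (-θ)) ≤ ∑ i ∈ Finset.range (j + 1), η i := by
    intro j hj
    have := Finset.card_nsmul_le_sum (Finset.range (j + 1)) η (c * (n : ℝ) ^ (-θ))
      (fun i hi => hη_low i (by have := Finset.mem_range.1 hi; omega))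
    simpa using this
  have hδ : ∀ j ≤ L, ∑ i ∈ Finset.range (j + 1), η i * (e (n - i) - e (n - j))
      ≤ ((j : ℝ) + 1) * (C * (2 ^ p * (n : ℝ) ^ (-p))) := by
    intro j hj
    -- The forward sum starting at `m = n - j`, read backwards.
    have h1 := hm (n - j) j (by omega)
    rw [← Finset.sum_range_reflect, ← Finset.sum_range_reflect (fun i => C * _)] at h1
    have h2 : ∀ i ∈ Finset.range (j + 1), n - j + (j + 1 - 1 - i) = n - i := fun i hi => by
      have := Finset.mem_range.1 hi; omega
    rw [Finset.sum_congr rfl (fun i hi => by rw [h2 i hi]),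
      Finset.sum_congr (f := fun i => C * _) rfl (fun i hi => by rw [h2 i hi])] at h1
    refine h1.trans ?_
    have := Finset.sum_le_card_nsmul (Finset.range (j + 1))
      (fun i => C * ((n - i : ℕ) : ℝ) ^ (-p)) (C * (2 ^ p * (n : ℝ) ^ (-p)))
      (fun i hi => mul_le_mul_of_nonneg_left
        (hp_up i (by have := Finset.mem_range.1 hi; omega)) hC)
    simpa using this
  have main := le_weighted_average_add (x := fun i => e (n - i)) hη_pos hδ
  simp only [Nat.sub_zero] at main
  refine main.trans ?_
  rw [add_mul]
  have hfirst : (∑ i ∈ Finset.range (L + 1), η i * e (n - i)) / ∑ i ∈ Finset.range (L + 1), η i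
      ≤ 2 * S / c * (n : ℝ) ^ (θ - 1) := by
    have h1 : ∑ i ∈ Finset.range (L + 1), η i * e (n - i) ≤ S := by
      have h0 := hS n
      rw [← Finset.sum_range_reflect, Finset.sum_congr rfl (g := fun i => η i * e (n - i))
        (fun i hi => by
          have : n - 1 - i + 1 = n - i := by have := Finset.mem_range.1 hi; omega
          rw [this])] at h0
      exact (Finset.sum_le_sum_of_subset_of_nonneg (Finset.range_subset_range.2 (by omega))
        fun i _ _ => mul_nonneg (by positivity) (he _)).trans h0
    have h2 := ht_low L le_rfl
    have h3 : (n : ℝ) / 2 ≤ (L : ℝ) + 1 := by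
      have : n ≤ 2 * (L + 1) := by omega
      have : (n : ℝ) ≤ 2 * ((L : ℝ) + 1) := by exact_mod_cast this
      linarith
    have h4 : (n : ℝ) / 2 * (c * (n : ℝ) ^ (-θ)) ≤ ∑ i ∈ Finset.range (L + 1), η i :=
      le_trans (by gcongr) h2
    calc _ ≤ S / ((n : ℝ) / 2 * (c * (n : ℝ) ^ (-θ))) := by gcongr
      _ = _ := by
        rw [Real.rpow_sub hn0, Real.rpow_one, Real.rpow_neg hn0.le]
        field_simp
  have hsecond : ∑ j ∈ Finset.range L, η (j + 1) *
        (((j + 1 : ℕ) + 1 : ℝ) * (C * (2 ^ p * (n : ℝ) ^ (-p)))) /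
        ((∑ i ∈ Finset.range (j + 1), η i) * ∑ i ∈ Finset.range (j + 2), η i)
      ≤ 2 ^ (θ + p) * C / c * (1 + 1 / (p - 1)) * (n : ℝ) ^ (θ - 1) := by
    -- The factor `j + 2` from the error cancels against the total weight of `j + 2` terms, leaving
    -- a harmonic sum.
    have h1 : ∀ j ∈ Finset.range L, η (j + 1) *
        (((j + 1 : ℕ) + 1 : ℝ) * (C * (2 ^ p * (n : ℝ) ^ (-p)))) /
        ((∑ i ∈ Finset.range (j + 1), η i) * ∑ i ∈ Finset.range (j + 2), η i)
        ≤ 2 ^ (θ + p) * C / c * (n : ℝ) ^ (θ - p) * ((j : ℝ) + 1)⁻¹ := by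
      intro j hj
      have hj := Finset.mem_range.1 hj
      have a1 := ht_low j (by omega)
      have a2 := ht_low (j + 1) (by omega)
      have a3 := hη_up (j + 1) (by omega)
      calc _ ≤ 2 ^ θ * c * (n : ℝ) ^ (-θ) *
            (((j + 1 : ℕ) + 1 : ℝ) * (C * (2 ^ p * (n : ℝ) ^ (-p)))) /
            (((j : ℝ) + 1) * (c * (n : ℝ) ^ (-θ)) *
              (((j + 1 : ℕ) + 1 : ℝ) * (c * (n : ℝ) ^ (-θ)))) := by gcongr
        _ = _ := by
          rw [Real.rpow_sub hn0, Real.rpow_add (by norm_num), Real.rpow_neg hn0.le,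
            Real.rpow_neg hn0.le]
          field_simp
    refine (Finset.sum_le_sum h1).trans ?_
    rw [← Finset.mul_sum]
    have hh : ∑ j ∈ Finset.range L, ((j : ℝ) + 1)⁻¹ ≤ 1 + Real.log n := by
      have h2 := harmonic_le_one_add_log L
      simp only [harmonic, Rat.cast_sum, Rat.cast_inv, Rat.cast_natCast, Nat.cast_add,
        Nat.cast_one, Rat.cast_add, Rat.cast_one] at h2
      refine h2.trans ?_
      have : 0 < L := by omega
      gcongr
      omega
    have hlog : 1 + Real.log n ≤ (1 + 1 / (p - 1)) * (n : ℝ) ^ (p - 1) := by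
      -- The logarithm is absorbed by the spare power `n^(p-1)`, so it does not appear in the rate.
      have h3 := Real.log_le_rpow_div hn0.le (sub_pos.2 hp)
      have h4 : 1 ≤ (n : ℝ) ^ (p - 1) :=
        Real.one_le_rpow (by exact_mod_cast (by omega : 1 ≤ n)) (by linarith)
      rw [add_mul, one_mul, one_div, inv_mul_eq_div]
      linarith
    calc _ ≤ 2 ^ (θ + p) * C / c * (n : ℝ) ^ (θ - p) *
          ((1 + 1 / (p - 1)) * (n : ℝ) ^ (p - 1)) := by
          gcongr
          exact hh.trans hlog
      _ = 2 ^ (θ + p) * C / c * (1 + 1 / (p - 1)) * ((n : ℝ) ^ (θ - p) * (n : ℝ) ^ (p - 1)) := by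
          ring
      _ = _ := by
          rw [← Real.rpow_add hn0]; ring_nf
  exact add_le_add hfirst hsecond

/-- Discrete Gronwall bound: `a (k + 1) + d k ≤ (1 + g k) a k + g k` with `∑ g` bounded. -/
theorem exists_bound_of_almost_decreasing {a d g : ℕ → ℝ} (ha : ∀ k, 0 ≤ a k) (hd : ∀ k, 0 ≤ d k)
    (hg : ∀ k, 0 ≤ g k) (hgs : Summable g) (h : ∀ k, a (k + 1) + d k ≤ a k + g k * (1 + a k)) :
    ∃ A, 0 ≤ A ∧ (∀ k, a k ≤ A) ∧ ∀ n, ∑ k ∈ Finset.range n, d k ≤ A := by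
  -- For `1 + a` the recursion is homogeneous, with factor `1 + g n ≤ exp (g n)`.
  have h1 : ∀ n, 1 + a n ≤ (1 + a 0) * Real.exp (∑ k ∈ Finset.range n, g k) := by
    intro n
    induction n with
    | zero => simp
    | succ n ih =>
      rw [Finset.sum_range_succ, Real.exp_add, ← mul_assoc]
      calc 1 + a (n + 1) ≤ (1 + a n) * (1 + g n) := by nlinarith [h n, hd n]
        _ ≤ _ := by
          have := Real.add_one_le_exp (g n)
          have := hg n
          have := ha n
          exact mul_le_mul ih (by linarith) (by linarith)
            (mul_nonneg (by linarith [ha 0]) (Real.exp_pos _).le)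
  set B := (1 + a 0) * Real.exp (∑' k, g k) with hB
  have h2 : ∀ n, 1 + a n ≤ B := fun n => (h1 n).trans (by
    have := ha 0
    have := hgs.sum_le_tsum (Finset.range n) (fun k _ => hg k)
    exact mul_le_mul_of_nonneg_left (Real.exp_le_exp.2 this) (by positivity))
  have hB0 : 0 ≤ B := by have := h2 0; have := ha 0; linarith
  have hG0 : 0 ≤ ∑' k, g k := tsum_nonneg hg
  refine ⟨B + (∑' k, g k) * B, by positivity, fun k => by
    have := h2 k; have := mul_nonneg hG0 hB0; linarith, fun n => ?_⟩
  have h3 : a n + ∑ k ∈ Finset.range n, d k ≤ a 0 + (∑ k ∈ Finset.range n, g k) * B := by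
    induction n with
    | zero => simp
    | succ n ih =>
      rw [Finset.sum_range_succ, Finset.sum_range_succ, add_mul]
      have := mul_le_mul_of_nonneg_left (h2 n) (hg n)
      linarith [h n]
  have h4 := mul_le_mul_of_nonneg_right
    (hgs.sum_le_tsum (Finset.range n) (fun k _ => hg k)) hB0
  linarith [ha n, h2 0]

end RealSequences

/-! ### Moments of the iterates and the recursion in expectation. -/

section Expectations

variable {E : Type*} [NormedAddCommGroup E] [NormedSpace ℝ E]
  {𝕎 Ω : Type*} [TopologicalSpace 𝕎] [MeasurableSpace 𝕎] [MeasurableSpace Ω]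
  {P : Measure Ω} {Uad O : Set E} {jC jA : E → 𝕎 → ℝ} {W : Ω → 𝕎}
  {K : E → ℝ} {gradK : E → StrongDual ℝ E} {b LK : ℝ}
  {ε : ℕ → ℝ} {u₀ : E} {ξ : ℕ → Ω → 𝕎} {G R : ℕ → Ω → StrongDual ℝ E} {U : ℕ → Ω → E}

theorem norm_sub_sq_le_two_mul {F : Type*} [SeminormedAddCommGroup F] (x y : F) :
    ‖x - y‖ ^ 2 ≤ 2 * ‖x‖ ^ 2 + 2 * ‖y‖ ^ 2 := by
  have h1 := norm_sub_le x y
  have h2 := norm_nonneg (x - y)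
  nlinarith [sq_nonneg (‖x‖ - ‖y‖)]

theorem IsAuxiliaryFunction.integrable_bregman [CompleteSpace E] [SecondCountableTopology E] [MeasurableSpace E]
    [BorelSpace E] (hK : IsAuxiliaryFunction Uad O K gradK b LK) {X Y : Ω → E} (hX : Measurable X)
    (hY : Measurable Y) (hXmem : ∀ ω, X ω ∈ Uad) (hYmem : ∀ ω, Y ω ∈ Uad)
    (hX2 : Integrable (fun ω => ‖X ω‖ ^ 2) P) (hY2 : Integrable (fun ω => ‖Y ω‖ ^ 2) P) :
    Integrable (fun ω => bregman K gradK (X ω) (Y ω)) P := by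
  refine Integrable.mono' (((hX2.const_mul 2).add (hY2.const_mul 2)).const_mul LK)
    (hK.measurable_bregman hX hY hYmem).aestronglyMeasurable (ae_of_all _ fun ω => ?_)
  rw [Real.norm_of_nonneg (hK.bregman_nonneg _ (hYmem ω))]
  exact (hK.bregman_le (hXmem ω) (hYmem ω)).trans
    (mul_le_mul_of_nonneg_left (norm_sub_sq_le_two_mul _ _) hK.LK_pos.le)

namespace IsStochasticAPP

/-- One step of the algorithm, uniformly over the comparison point. -/
theorem bregman_step_ae (hprob : IsMasterProblem P Uad jC jA W)
    (hK : IsAuxiliaryFunction Uad O K gradK b LK)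
    (halg : IsStochasticAPP P Uad jC jA W K gradK ε u₀ ξ G R U) {a : ℝ}
    (ha : ∀ u ∈ Uad, ∀ w, ∀ g ∈ subdiff (fun v => jC v w) u,
      ∃ s ∈ subdiff (fun v => jA v w) u, ‖g‖ + ‖s‖ ≤ a * (1 + ‖u‖))
    {k : ℕ} {Q B : ℝ} (hQ0 : 0 ≤ Q) (hQB : Q ≤ B) (hR : ∀ᵐ ω ∂P, ‖R k ω‖ ≤ Q) :
    ∀ᵐ ω ∂P, ∀ u ∈ Uad, bregman K gradK u (U (k + 1) ω) ≤ bregman K gradK u (U k ω)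
      + ε k * ((jC u (ξ k ω) + jA u (ξ k ω)) - (jC (U k ω) (ξ k ω) + jA (U k ω) (ξ k ω)))
      + ((a + B) ^ 2 / b + 1) * (ε k ^ 2 + ε k * Q) * (1 + ‖U k ω‖ ^ 2 + ‖u‖ ^ 2) := by
  -- The exceptional null set comes from `R k` alone, so `u` may later be chosen depending on `ω`.
  filter_upwards [hR] with ω hω u hu
  have hε := halg.step_pos k
  have hb := hK.b_pos
  obtain ⟨s, hs, hgs⟩ := ha _ (halg.mem k ω) _ _ (halg.subgrad k ω)
  set x := ‖U k ω‖ with hx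
  have hx0 : 0 ≤ x := norm_nonneg _
  have hM : ‖G k ω‖ + ‖s‖ + ‖R k ω‖ ≤ (a + B) * (1 + x) := by nlinarith [mul_nonneg (hQ0.trans hQB) hx0]
  refine (hK.bregman_step hprob.convex (hprob.convex_jA _) hε (halg.mem k ω) (halg.next_mem k ω)
    (halg.subgrad k ω) hs hM (halg.next_min k ω) hu).trans ?_
  have h1 : ε k ^ 2 * ((a + B) * (1 + x)) ^ 2 / (2 * b)
      ≤ (a + B) ^ 2 / b * ε k ^ 2 * (1 + x ^ 2 + ‖u‖ ^ 2) := by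
    have e : ε k ^ 2 * ((a + B) * (1 + x)) ^ 2 / (2 * b)
      = (a + B) ^ 2 / b * ε k ^ 2 * ((1 + x) ^ 2 / 2) := by field_simp
    rw [e]
    refine mul_le_mul_of_nonneg_left ?_ (by positivity)
    nlinarith [sq_nonneg (1 - x), sq_nonneg ‖u‖]
  have h2 : ε k * (‖R k ω‖ * ‖u - U k ω‖) ≤ ε k * Q * (1 + x ^ 2 + ‖u‖ ^ 2) := by
    rw [mul_assoc]
    refine mul_le_mul_of_nonneg_left (mul_le_mul hω ?_ (norm_nonneg _) hQ0) hε.le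
    have := norm_sub_le u (U k ω)
    nlinarith [sq_nonneg (‖u‖ - 1 / 2), sq_nonneg (x - 1 / 2)]
  -- Nonnegative cross terms, added to factor the two errors as a single product.
  have h3 : 0 ≤ (a + B) ^ 2 / b * (ε k * Q) * (1 + x ^ 2 + ‖u‖ ^ 2) := by positivity
  have h4 : 0 ≤ ε k ^ 2 * (1 + x ^ 2 + ‖u‖ ^ 2) := by positivity
  linarith

variable [CompleteSpace E] [SecondCountableTopology E] [MeasurableSpace E] [BorelSpace E] [OpensMeasurableSpace 𝕎]

theorem measurable_iterate_ambient (hprob : IsMasterProblem P Uad jC jA W)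
    (hK : IsAuxiliaryFunction Uad O K gradK b LK)
    (halg : IsStochasticAPP P Uad jC jA W K gradK ε u₀ ξ G R U) (k : ℕ) : Measurable (U k) :=
  (halg.measurable_iterate hprob hK k).mono (halg.sampleSigma_le k) le_rfl

/-- The iterates are square integrable. -/
theorem integrable_sq_norm [IsFiniteMeasure P] (hprob : IsMasterProblem P Uad jC jA W)
    (hK : IsAuxiliaryFunction Uad O K gradK b LK)
    (halg : IsStochasticAPP P Uad jC jA W K gradK ε u₀ ξ G R U) {a : ℝ}
    (ha : ∀ u ∈ Uad, ∀ w, ∀ g ∈ subdiff (fun v => jC v w) u,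
      ∃ s ∈ subdiff (fun v => jA v w) u, ‖g‖ + ‖s‖ ≤ a * (1 + ‖u‖))
    {Q : ℕ → ℝ} {B : ℝ} (hQ0 : ∀ k, 0 ≤ Q k) (hQB : ∀ k, Q k ≤ B)
    (hR : ∀ k, ∀ᵐ ω ∂P, ‖R k ω‖ ≤ Q k) (k : ℕ) : Integrable (fun ω => ‖U k ω‖ ^ 2) P := by
  induction k with
  | zero => simp [halg.start]
  | succ k ih =>
    have hb := hK.b_pos
    set C := ((a + B) ^ 2 / b + 1) * (ε k ^ 2 + ε k * Q k) with hC
    refine Integrable.mono' ((ih.const_mul 2).add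
      (((integrable_const (1 : ℝ)).add (ih.const_mul 2)).const_mul (2 * (2 / b * C))))
      ((halg.measurable_iterate_ambient hprob hK (k + 1)).norm.pow_const 2).aestronglyMeasurable ?_
    filter_upwards [halg.bregman_step_ae hprob hK ha (hQ0 k) (hQB k) (hR k)] with ω hω
    -- Comparing with `U k` itself cancels the cost, so strong convexity bounds the displacement by
    -- the error term.
    have h1 := hω (U k ω) (halg.mem k ω)
    rw [bregman_self, sub_self, mul_zero, zero_add, zero_add] at h1
    have h2 := (hK.le_bregman (U k ω) (halg.next_mem k ω)).trans h1
    have h3 := norm_sub_sq_le_two_mul (U k ω) (U k ω - U (k + 1) ω)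
    rw [sub_sub_cancel] at h3
    rw [Real.norm_of_nonneg (by positivity)]
    simp only [Pi.add_apply]
    have h4 : ‖U k ω - U (k + 1) ω‖ ^ 2 ≤ 2 / b * C * (1 + 2 * ‖U k ω‖ ^ 2) := by
      have := mul_le_mul_of_nonneg_left h2 (by positivity : 0 ≤ 2 / b)
      calc _ = 2 / b * (b / 2 * ‖U k ω - U (k + 1) ω‖ ^ 2) := by field_simp
        _ ≤ _ := this
        _ = _ := by ring
    linarith

/-- The sampled cost at a square integrable point is integrable. -/
theorem integrable_cost [IsFiniteMeasure P] (hprob : IsMasterProblem P Uad jC jA W)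
    (halg : IsStochasticAPP P Uad jC jA W K gradK ε u₀ ξ G R U) {a : ℝ} (ha0 : 0 < a)
    (ha : ∀ u ∈ Uad, ∀ w, ∀ g ∈ subdiff (fun v => jC v w) u,
      ∃ s ∈ subdiff (fun v => jA v w) u, ‖g‖ + ‖s‖ ≤ a * (1 + ‖u‖))
    {X : Ω → E} (hX : Measurable X) (hmem : ∀ ω, X ω ∈ Uad)
    (hX2 : Integrable (fun ω => ‖X ω‖ ^ 2) P) (k : ℕ) :
    Integrable (fun ω => jC (X ω) (ξ k ω) + jA (X ω) (ξ k ω)) P := by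
  have hu := halg.start_mem
  have h0 : Integrable (fun ω => jC u₀ (ξ k ω) + jA u₀ (ξ k ω)) P :=
    (((halg.identDistrib k).comp (hprob.measurable_jC u₀)).integrable_iff.2
      (hprob.integrable_jC u₀ hu)).add
    (((halg.identDistrib k).comp (hprob.measurable_jA u₀)).integrable_iff.2
      (hprob.integrable_jA u₀ hu))
  have h1 : Integrable (fun ω => (jC (X ω) (ξ k ω) + jA (X ω) (ξ k ω))
      - (jC u₀ (ξ k ω) + jA u₀ (ξ k ω))) P := by
    refine Integrable.mono' (((integrable_const (1 + 4 * ‖u₀‖ ^ 2)).add (hX2.const_mul 4)).const_mul a)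
      (((hprob.measurable_uncurry.comp (hX.prodMk (halg.measurable_ξ k))).aestronglyMeasurable).sub
        h0.aestronglyMeasurable) (ae_of_all _ fun ω => ?_)
    refine (hprob.abs_sub_le_of_subgrad_bound ha0 ha (hmem ω) hu (ξ k ω)).trans ?_
    rw [mul_assoc]
    refine mul_le_mul_of_nonneg_left ?_ ha0.le
    simp only [Pi.add_apply]
    nlinarith [sq_nonneg (‖X ω‖ - ‖u₀‖), sq_nonneg (‖X ω‖ + ‖u₀‖ - 1)]
  exact (h1.add h0).congr (ae_of_all _ fun ω => sub_add_cancel _ _)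

/-- One step of the algorithm in expectation. -/
theorem integral_bregman_step [IsProbabilityMeasure P] (hprob : IsMasterProblem P Uad jC jA W)
    (hK : IsAuxiliaryFunction Uad O K gradK b LK)
    (halg : IsStochasticAPP P Uad jC jA W K gradK ε u₀ ξ G R U) {a : ℝ} (ha0 : 0 < a)
    (ha : ∀ u ∈ Uad, ∀ w, ∀ g ∈ subdiff (fun v => jC v w) u,
      ∃ s ∈ subdiff (fun v => jA v w) u, ‖g‖ + ‖s‖ ≤ a * (1 + ‖u‖))
    {Q : ℕ → ℝ} {B : ℝ} (hQ0 : ∀ k, 0 ≤ Q k) (hQB : ∀ k, Q k ≤ B)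
    (hR : ∀ k, ∀ᵐ ω ∂P, ‖R k ω‖ ≤ Q k) {k : ℕ} {X : Ω → E} (hX : Measurable[sampleSigma ξ k] X)
    (hmem : ∀ ω, X ω ∈ Uad) (hX2 : Integrable (fun ω => ‖X ω‖ ^ 2) P) :
    ∫ ω, bregman K gradK (X ω) (U (k + 1) ω) ∂P ≤ ∫ ω, bregman K gradK (X ω) (U k ω) ∂P
      + ε k * (∫ ω, objective P jC jA W (X ω) ∂P - ∫ ω, objective P jC jA W (U k ω) ∂P)
      + ((a + B) ^ 2 / b + 1) * (ε k ^ 2 + ε k * Q k)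
        * (1 + ∫ ω, ‖U k ω‖ ^ 2 ∂P + ∫ ω, ‖X ω‖ ^ 2 ∂P) := by
  have hXm : Measurable X := hX.mono (halg.sampleSigma_le k) le_rfl
  have hUm := halg.measurable_iterate_ambient hprob hK
  have hU2 := halg.integrable_sq_norm hprob hK ha hQ0 hQB hR
  have hD := fun n => hK.integrable_bregman hXm (hUm n) hmem (halg.mem n) hX2 (hU2 n)
  have hcX := halg.integrable_cost hprob ha0 ha hXm hmem hX2 k
  have hcU := halg.integrable_cost hprob ha0 ha (hUm k) (halg.mem k) (hU2 k) k
  have hJX := (hprob.integral_objective_comp hXm (halg.measurable_ξ k) hmem (halg.identDistrib k)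
    (halg.indepFun_of_measurable hX) hcX).2
  have hJU := (hprob.integral_objective_comp (hUm k) (halg.measurable_ξ k) (halg.mem k)
    (halg.identDistrib k) (halg.indepFun_of_measurable (halg.measurable_iterate hprob hK k)) hcU).2
  have hU1 : Integrable (fun ω => 1 + ‖U k ω‖ ^ 2) P := (integrable_const (1 : ℝ)).add (hU2 k)
  have hsq : Integrable (fun ω => 1 + ‖U k ω‖ ^ 2 + ‖X ω‖ ^ 2) P := hU1.add hX2
  have hdiff : Integrable (fun ω => ε k * ((jC (X ω) (ξ k ω) + jA (X ω) (ξ k ω))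
      - (jC (U k ω) (ξ k ω) + jA (U k ω) (ξ k ω)))) P := (hcX.sub hcU).const_mul (ε k)
  have hsum : Integrable (fun ω => bregman K gradK (X ω) (U k ω)
      + ε k * ((jC (X ω) (ξ k ω) + jA (X ω) (ξ k ω))
      - (jC (U k ω) (ξ k ω) + jA (U k ω) (ξ k ω)))) P := (hD k).add hdiff
  have hsq' : ∫ ω, (1 + ‖U k ω‖ ^ 2 + ‖X ω‖ ^ 2) ∂P
      = 1 + ∫ ω, ‖U k ω‖ ^ 2 ∂P + ∫ ω, ‖X ω‖ ^ 2 ∂P := by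
    rw [integral_add hU1 hX2, integral_add (integrable_const 1) (hU2 k)]
    simp
  rw [hJX, hJU, ← integral_sub hcX hcU, ← hsq', ← integral_const_mul, ← integral_const_mul,
    ← integral_add (hD k) hdiff, ← integral_add hsum (hsq.const_mul _)]
  refine integral_mono_ae (hD (k + 1)) (hsum.add (hsq.const_mul _)) ?_
  filter_upwards [halg.bregman_step_ae hprob hK ha (hQ0 k) (hQB k) (hR k)] with ω hω
  exact hω (X ω) (hmem ω)

theorem integrable_objective [IsProbabilityMeasure P] (hprob : IsMasterProblem P Uad jC jA W)
    (hK : IsAuxiliaryFunction Uad O K gradK b LK)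
    (halg : IsStochasticAPP P Uad jC jA W K gradK ε u₀ ξ G R U) {a : ℝ} (ha0 : 0 < a)
    (ha : ∀ u ∈ Uad, ∀ w, ∀ g ∈ subdiff (fun v => jC v w) u,
      ∃ s ∈ subdiff (fun v => jA v w) u, ‖g‖ + ‖s‖ ≤ a * (1 + ‖u‖))
    {k : ℕ} (hU2 : Integrable (fun ω => ‖U k ω‖ ^ 2) P) :
    Integrable (fun ω => objective P jC jA W (U k ω)) P :=
  have hUm := halg.measurable_iterate_ambient hprob hK k
  (hprob.integral_objective_comp hUm (halg.measurable_ξ k) (halg.mem k)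
    (halg.identDistrib k) (halg.indepFun_of_measurable (halg.measurable_iterate hprob hK k))
    (halg.integrable_cost hprob ha0 ha hUm (halg.mem k) hU2 k)).1

/-- Convergence rate of the objective along the iterates. -/
theorem isBigO_objective [IsProbabilityMeasure P] (hprob : IsMasterProblem P Uad jC jA W)
    (hK : IsAuxiliaryFunction Uad O K gradK b LK)
    (halg : IsStochasticAPP P Uad jC jA W K gradK ε u₀ ξ G R U) {a : ℝ} (ha0 : 0 < a)
    (ha : ∀ u ∈ Uad, ∀ w, ∀ g ∈ subdiff (fun v => jC v w) u,
      ∃ s ∈ subdiff (fun v => jA v w) u, ‖g‖ + ‖s‖ ≤ a * (1 + ‖u‖))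
    {Q : ℕ → ℝ} {B : ℝ} (hQ0 : ∀ k, 0 ≤ Q k) (hQB : ∀ k, Q k ≤ B)
    (hR : ∀ k, ∀ᵐ ω ∂P, ‖R k ω‖ ≤ Q k) {c θ p D : ℝ} (hc : 0 < c) (hθ0 : 0 < θ) (hθ1 : θ < 1)
    (hε : ∀ k : ℕ, 1 ≤ k → ε k = c * (k : ℝ) ^ (-θ)) (hp : 1 < p)
    (hD : ∀ k : ℕ, 1 ≤ k → ε k ^ 2 + ε k * Q k ≤ D * (k : ℝ) ^ (-p))
    {ustar : E} (hustar : ustar ∈ Uad) (hmin : IsMinOn (objective P jC jA W) Uad ustar) :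
    (fun n : ℕ => ∫ ω, (objective P jC jA W (U n ω) - objective P jC jA W ustar) ∂P)
      =O[atTop] fun n : ℕ => (n : ℝ) ^ (θ - 1) := by
  have hb := hK.b_pos
  have hUm := halg.measurable_iterate_ambient hprob hK
  have hU2 := halg.integrable_sq_norm hprob hK ha hQ0 hQB hR
  have hJ := fun k => halg.integrable_objective hprob hK ha0 ha (hU2 k)
  set e : ℕ → ℝ := fun n => ∫ ω, (objective P jC jA W (U n ω) - objective P jC jA W ustar) ∂P
    with he_def
  have he : ∀ n, e n = ∫ ω, objective P jC jA W (U n ω) ∂P - objective P jC jA W ustar := fun n => by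
    simp only [he_def]
    rw [integral_sub (hJ n) (integrable_const _)]
    simp
  have he0 : ∀ n, 0 ≤ e n := fun n =>
    integral_nonneg fun ω => sub_nonneg.2 (isMinOn_iff.1 hmin _ (halg.mem n ω))
  set C := (a + B) ^ 2 / b + 1 with hC_def
  have hC : 0 < C := by positivity
  set g : ℕ → ℝ := fun k => ε k ^ 2 + ε k * Q k with hg_def
  have hg : ∀ k, 0 ≤ g k := fun k => by
    have := (halg.step_pos k).le
    have := hQ0 k
    positivity
  have hgs : Summable g := by
    refine Summable.of_norm_bounded_eventually_nat
      (((Real.summable_nat_rpow (p := -p)).2 (by linarith)).mul_left D) ?_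
    filter_upwards [eventually_ge_atTop 1] with k hk
    rw [Real.norm_of_nonneg (hg k)]
    exact hD k hk
  set A : ℕ → ℝ := fun k => ∫ ω, bregman K gradK ustar (U k ω) ∂P with hA_def
  have hA0 : ∀ k, 0 ≤ A k := fun k =>
    integral_nonneg fun ω => hK.bregman_nonneg _ (halg.mem k ω)
  -- Strong convexity bounds second moments by the expected divergence: `4 / b` is `2` from the
  -- parallelogram-type bound times `2 / b`.
  have hsq : ∀ k, ∫ ω, ‖U k ω‖ ^ 2 ∂P ≤ 2 * ‖ustar‖ ^ 2 + 4 / b * A k := fun k => by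
    have hD := hK.integrable_bregman (P := P) measurable_const (hUm k) (fun _ => hustar)
      (halg.mem k) (integrable_const _) (hU2 k)
    have h1 : ∫ ω, (2 * ‖ustar‖ ^ 2 + 4 / b * bregman K gradK ustar (U k ω)) ∂P
        = 2 * ‖ustar‖ ^ 2 + 4 / b * A k := by
      rw [integral_add (integrable_const _) (hD.const_mul _), integral_const_mul (4 / b)]
      simp only [hA_def, integral_const, probReal_univ, one_smul]
    rw [← h1]
    refine integral_mono (hU2 k) ((integrable_const _).add (hD.const_mul _)) fun ω => ?_
    have h2 := norm_sub_sq_le_two_mul ustar (ustar - U k ω)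
    rw [sub_sub_cancel] at h2
    have h3 := mul_le_mul_of_nonneg_left (hK.le_bregman ustar (halg.mem k ω))
      (by positivity : 0 ≤ 4 / b)
    have h4 : 4 / b * (b / 2 * ‖ustar - U k ω‖ ^ 2) = 2 * ‖ustar - U k ω‖ ^ 2 := by
      field_simp; norm_num
    simp only
    linarith
  set C' := C * (1 + 3 * ‖ustar‖ ^ 2 + 4 / b) with hC'_def
  -- First use of the one-step inequality: comparison with the minimizer.
  have hrec : ∀ k, A (k + 1) + ε k * e k ≤ A k + C' * g k * (1 + A k) := fun k => by
    have h1 := halg.integral_bregman_step hprob hK ha0 ha hQ0 hQB hR (k := k)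
      (X := fun _ => ustar) measurable_const (fun _ => hustar) (integrable_const _)
    simp only [integral_const, probReal_univ, one_smul] at h1
    have h2 : 1 + ∫ ω, ‖U k ω‖ ^ 2 ∂P + ‖ustar‖ ^ 2
        ≤ (1 + 3 * ‖ustar‖ ^ 2 + 4 / b) * (1 + A k) := by
      have := hA0 k
      have : 0 ≤ (1 + 3 * ‖ustar‖ ^ 2) * A k := by positivity
      have : 0 ≤ 4 / b := by positivity
      linarith [hsq k]
    have h3 := mul_le_mul_of_nonneg_left h2 (mul_nonneg hC.le (hg k))
    have h4 := he k
    simp only [hA_def, hg_def, hC'_def] at *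
    rw [h4]
    linarith
  have hC'0 : 0 ≤ C' := by positivity
  obtain ⟨S, hS0, hAS, hsum⟩ := exists_bound_of_almost_decreasing hA0
    (fun k => mul_nonneg (halg.step_pos k).le (he0 k)) (fun k => mul_nonneg hC'0 (hg k))
    (hgs.mul_left C') hrec
  set N := 2 * ‖ustar‖ ^ 2 + 4 / b * S with hN_def
  have hN : ∀ k, ∫ ω, ‖U k ω‖ ^ 2 ∂P ≤ N := fun k =>
    (hsq k).trans (by have := hAS k; simp only [hN_def]; gcongr)
  have hN0 : 0 ≤ N := by positivity
  have hD0 : 0 ≤ D := by simpa using (hg 1).trans (hD 1 le_rfl)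
  refine isBigO_rpow_of_weighted_sums (S := S) (C := C * (1 + 2 * N) * D) he0 hc hθ0 hθ1 hp
    (by positivity) (fun n => ?_) (fun m l hm => ?_)
  · have h1 := hsum (n + 1)
    rw [Finset.sum_range_succ'] at h1
    have h2 := mul_nonneg (halg.step_pos 0).le (he0 0)
    refine le_trans (Finset.sum_congr rfl fun k _ => ?_).le (by linarith : _ ≤ S)
    rw [hε (k + 1) (by omega)]
  -- Second use: comparison with the iterate `U m`, which is measurable for the samples before every
  -- `ξ (m + i)`. The divergences telescope from `β 0 = 0`.
  · set β : ℕ → ℝ := fun i => ∫ ω, bregman K gradK (U m ω) (U (m + i) ω) ∂P with hβ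
    have hstep : ∀ i, ε (m + i) * (e (m + i) - e m)
        ≤ β i - β (i + 1) + C * (1 + 2 * N) * D * ((m + i : ℕ) : ℝ) ^ (-p) := fun i => by
      have h1 := halg.integral_bregman_step hprob hK ha0 ha hQ0 hQB hR (k := m + i)
        ((halg.measurable_iterate hprob hK m).mono (sampleSigma_mono ξ (m.le_add_right i)) le_rfl)
        (halg.mem m) (hU2 m)
      have h2 := mul_le_mul (mul_le_mul_of_nonneg_left (hD (m + i) (by omega)) hC.le)
        (by linarith [hN m, hN (m + i)] :
          1 + ∫ ω, ‖U (m + i) ω‖ ^ 2 ∂P + ∫ ω, ‖U m ω‖ ^ 2 ∂P ≤ 1 + 2 * N)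
        (by positivity) (by positivity)
      rw [he, he]
      simp only [hβ, ← add_assoc]
      linarith
    have h0 : β 0 = 0 := by simp [hβ, bregman_self]
    have hβ0 : 0 ≤ β (l + 1) := integral_nonneg fun ω => hK.bregman_nonneg _ (halg.mem _ ω)
    have h3 := Finset.sum_le_sum fun i (_ : i ∈ Finset.range (l + 1)) => hstep i
    rw [Finset.sum_add_distrib, Finset.sum_range_sub', h0] at h3
    refine (Finset.sum_congr rfl fun i _ => ?_).trans_le (h3.trans (by linarith))
    rw [hε (m + i) (by omega)]

end IsStochasticAPP

end Expectations

/-! ### Assembly: real-valued error bounds and the choice of exponent. -/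

theorem mainTheorem4
    {E : Type*} [NormedAddCommGroup E] [NormedSpace ℝ E] [CompleteSpace E]
    [TopologicalSpace.SeparableSpace E] (hrefl : ReflexiveSpace E)
    [TopologicalSpace.SeparableSpace (StrongDual ℝ E)]
    {𝕎 : Type*} [AddCommGroup 𝕎] [Module ℝ 𝕎] [TopologicalSpace 𝕎] [IsTopologicalAddGroup 𝕎]
    [ContinuousSMul ℝ 𝕎] [MeasurableSpace 𝕎] [BorelSpace 𝕎]
    {Ω : Type*} [MeasurableSpace Ω] (P : Measure Ω) [IsProbabilityMeasure P] [P.IsComplete]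
    (Uad O : Set E) (jC jA : E → 𝕎 → ℝ) (W : Ω → 𝕎)
    (hprob : IsMasterProblem P Uad jC jA W)
    (K : E → ℝ) (gradK : E → StrongDual ℝ E) (b LK : ℝ)
    (hK : IsAuxiliaryFunction Uad O K gradK b LK)
    (ε : ℕ → ℝ) (u₀ : E) (ξ : ℕ → Ω → 𝕎) (G R : ℕ → Ω → StrongDual ℝ E) (U : ℕ → Ω → E)
    (halg : IsStochasticAPP P Uad jC jA W K gradK ε u₀ ξ G R U)
    (hbias : ∑' k, essSupNorm P (R k) * ENNReal.ofReal (ε k) < ∞)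
    (c θ : ℝ) (hc : 0 < c) (hθ : 1 / 2 < θ) (hθ1 : θ < 1)
    (hε : ∀ k : ℕ, 1 ≤ k → ε k = c * (k : ℝ) ^ (-θ))
    (q ν : ℝ) (hq : 0 < q) (hν : 1 - θ < ν)
    (hQ : ∀ k : ℕ, 1 ≤ k → essSupNorm P (R k) ≤ ENNReal.ofReal (q * (k : ℝ) ^ (-ν)))
    (ustar : E) (hustar : ustar ∈ Uad)
    (hmin : IsMinOn (objective P jC jA W) Uad ustar) :
    (∀ n, Integrable (fun ω => objective P jC jA W (U n ω)) P) ∧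
    (fun n : ℕ => ∫ ω, (objective P jC jA W (U n ω) - objective P jC jA W ustar) ∂P)
      =O[atTop] (fun n : ℕ => (n : ℝ) ^ (θ - 1)) ∧
    (∀ δ : ℝ, θ ≤ 1 / 2 + δ →
      (fun n : ℕ => ∫ ω, (objective P jC jA W (U n ω) - objective P jC jA W ustar) ∂P)
        =O[atTop] (fun n : ℕ => (n : ℝ) ^ (-(1 / 2) + δ))) := by
  borelize E
  have := UniformSpace.secondCountable_of_separable E
  obtain ⟨a, ha0, ha⟩ := hprob.exists_subgrad_bound
  set Q : ℕ → ℝ := fun k => (essSupNorm P (R k)).toReal with hQ_def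
  have hfin : ∀ k, essSupNorm P (R k) ≠ ∞ := fun k h => by
    have h1 := (ENNReal.le_tsum k).trans_lt hbias
    rw [h, ENNReal.top_mul (ENNReal.ofReal_pos.2 (halg.step_pos k)).ne'] at h1
    exact lt_irrefl _ h1
  have hQ0 : ∀ k, 0 ≤ Q k := fun k => ENNReal.toReal_nonneg
  have hQle : ∀ k : ℕ, 1 ≤ k → Q k ≤ q * (k : ℝ) ^ (-ν) := fun k hk =>
    ENNReal.toReal_le_of_le_ofReal (by positivity) (hQ k hk)
  -- The power bound says nothing about `k = 0`; there `Q 0` is finite because the series in `hbias`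
  -- converges and `ε 0 > 0`.
  have hQB : ∀ k, Q k ≤ max (Q 0) q := fun k => by
    rcases Nat.eq_zero_or_pos k with rfl | hk
    · exact le_max_left _ _
    · refine ((hQle k hk).trans ?_).trans (le_max_right _ _)
      exact mul_le_of_le_one_right hq.le
        (Real.rpow_le_one_of_one_le_of_nonpos (by exact_mod_cast hk) (by linarith))
  have hR : ∀ k, ∀ᵐ ω ∂P, ‖R k ω‖ ≤ Q k := fun k => by
    filter_upwards [ENNReal.ae_le_essSup fun ω => ‖R k ω‖ₑ] with ω hω
    rw [← toReal_enorm]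
    exact ENNReal.toReal_mono (hfin k) hω
  -- The exponent `2θ` comes from `ε k ^ 2` and `θ + ν` from `ε k * Q k`; the hypotheses on `θ` and
  -- `ν` say that both exceed `1`.
  have hD : ∀ k : ℕ, 1 ≤ k → ε k ^ 2 + ε k * Q k
      ≤ (c ^ 2 + c * q) * (k : ℝ) ^ (-(min (2 * θ) (θ + ν))) := fun k hk => by
    have hk1 : (1 : ℝ) ≤ k := by exact_mod_cast hk
    have hk0 : (0 : ℝ) < k := by linarith
    have h1 : ε k * Q k ≤ c * (k : ℝ) ^ (-θ) * (q * (k : ℝ) ^ (-ν)) := by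
      rw [hε k hk]
      exact mul_le_mul_of_nonneg_left (hQle k hk) (by positivity)
    have h2 : (k : ℝ) ^ (-θ) * (k : ℝ) ^ (-θ) ≤ (k : ℝ) ^ (-(min (2 * θ) (θ + ν))) := by
      rw [← Real.rpow_add hk0]
      exact Real.rpow_le_rpow_of_exponent_le hk1 (by linarith [min_le_left (2 * θ) (θ + ν)])
    have h3 : (k : ℝ) ^ (-θ) * (k : ℝ) ^ (-ν) ≤ (k : ℝ) ^ (-(min (2 * θ) (θ + ν))) := by
      rw [← Real.rpow_add hk0]
      exact Real.rpow_le_rpow_of_exponent_le hk1 (by linarith [min_le_right (2 * θ) (θ + ν)])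
    calc ε k ^ 2 + ε k * Q k ≤ c ^ 2 * ((k : ℝ) ^ (-θ) * (k : ℝ) ^ (-θ))
          + c * q * ((k : ℝ) ^ (-θ) * (k : ℝ) ^ (-ν)) := by
          rw [hε k hk] at h1 ⊢
          linarith
      _ ≤ c ^ 2 * (k : ℝ) ^ (-(min (2 * θ) (θ + ν)))
          + c * q * (k : ℝ) ^ (-(min (2 * θ) (θ + ν))) := by gcongr
      _ = _ := by ring
  have hrate := halg.isBigO_objective hprob hK ha0 ha hQ0 hQB hR hc (by linarith) hθ1 hε
    (lt_min (by linarith) (by linarith)) hD hustar hmin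
  refine ⟨fun n => halg.integrable_objective hprob hK ha0 ha
    (halg.integrable_sq_norm hprob hK ha hQ0 hQB hR n), hrate, fun δ hδ => hrate.trans ?_⟩
  refine IsBigO.of_bound 1 ?_
  filter_upwards [eventually_ge_atTop 1] with n hn
  rw [one_mul, Real.norm_of_nonneg (by positivity), Real.norm_of_nonneg (by positivity)]
  exact Real.rpow_le_rpow_of_exponent_le (by exact_mod_cast hn) (by linarith)
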